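/- Consider the discrete-time AWGN channel with noise variance $\sigma^2>0$: the output in slot $n$ is $y_n=x_n+w_n$, with $w_n$ i.i.d. $\mathcal N(0,\sigma^2)$. A sync word $s=(s_1,\dots,s_N)$, $N\ge 1$, with symbols in an alphabet $\mathcal X_P$ is sent in the slots $v,\dots,v+N-1$, where $v$ is uniform on $\{1,\dots,A\}$; in all other slots the input is $0$. Here $P>0$ is the symbol power and, for each $P>0$, $\mathcal X_P$ is any fixed set with $\{0,\sqrt P\}\subseteq\mathcal X_P\subseteq[-\sqrt P,\sqrt P]$. A sequential decoder is an estimate $\hat v\in\{1,\dots,A\}$ of $v$ such that, for each $t$, the event $\{\hat v=t\}$ depends (measurably) only on $y_1,\dots,y_{t+N-1}$. For sequences $A_k,N_k\ge 1$ of integers and $P_k>0$, say that error-free synchronisation is possible if there are sync words of length $N_k$ over $\mathcal X_{P_k}$ and sequential decoders with $\mathsf P(\hat v\ne v)\to 0$ as $k\to\infty$. Write $E_k=N_kP_k$ for the sync packet energy. An exponent $\alpha>0$ is achievable along $(N_k,P_k)$ if error-free synchronisation is possible with $A_k=\lfloor e^{\alpha E_k}\rfloor$; it is achievable if it is achievable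 along some $(N_k,P_k)$ with $E_k\to\infty$. Lemma. (1) The synchronisation threshold with respect to the sync packet energy, that is, the supremum of the achievable exponents, equals $\frac1{2\sigma^2}$. (2) The same holds for every way of scaling the energy with power bounded away from zero: if $N_kP_k\to\infty$ and $\inf_k P_k>0$ (in particular if $P_k=P$ and $N_k\to\infty$, or $P_k\to\infty$ and $N_k\to\infty$, or $N_k=N$ and $P_k\to\infty$), then the supremum of the exponents achievable along $(N_k,P_k)$ equals $\frac1{2\sigma^2}$. (3) Let $A_k\to\infty$. If $\inf_k P_k>0$ and, for some $\varepsilon>0$, $e^{E_k/(2\sigma^2)}\ge A_k^{1+\varepsilon}$ for all large $k$, then error-free synchronisation is possible. If, for some $\varepsilon>0$, $e^{E_k/(2\sigma^2)}\le A_k^{1-\varepsilon}$ for infinitely many $k$, then it is not possible. -/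

import Mathlib

open MeasureTheory ProbabilityTheory Filter Topology

noncomputable section

/-- The channel input in the slots `0, …, A + N - 2` when the sync word `s` of length `N` starts in
slot `v`: `x_n = s_{n - v}` for `v ≤ n < v + N`, and the zero symbol in all other slots.
(Slots, positions in the word and starting times are counted from `0` instead of from `1`.) -/
def channelInput {A N : ℕ} (s : Fin N → ℝ) (v : Fin A) (n : Fin (A + N - 1)) : ℝ :=
  if h : v.val ≤ n.val ∧ n.val < v.val + N then s ⟨n.val - v.val, by omega⟩ else 0

/-- Law of the output of the AWGN channel with noise variance `σ ^ 2` and input `x`: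
the outputs `y_n = x_n + w_n` are independent with law `N(x_n, σ ^ 2)`. -/
def awgnOutput (σ : ℝ) {m : ℕ} (x : Fin m → ℝ) : Measure (Fin m → ℝ) :=
  Measure.pi fun n => gaussianReal (x n) (σ ^ 2).toNNReal

/-- `vhat` is a sequential decoder: the event that `vhat` declares the start `t` is an event about
the outputs in the slots up to and including `t + N - 1` only. -/
def IsSequentialDecoder {A N : ℕ} (vhat : (Fin (A + N - 1) → ℝ) → Fin A) : Prop :=
  ∀ t : Fin A, MeasurableSet {y | vhat y = t} ∧
    ∀ y y' : Fin (A + N - 1) → ℝ, (∀ n, n.val < t.val + N → y n = y' n) →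
      (vhat y = t ↔ vhat y' = t)

/-- The probability of `vhat ≠ v`, for a start `v` uniform on the `A` possible slots. -/
def syncErrorProb (σ : ℝ) {A N : ℕ} (s : Fin N → ℝ)
    (vhat : (Fin (A + N - 1) → ℝ) → Fin A) : ℝ :=
  (∑ v : Fin A, (awgnOutput σ (channelInput s v)).real {y | vhat y ≠ v}) / A

/-- Error-free synchronisation is possible asymptotically, for interval lengths `A k`, word lengths
`N k` and symbol powers `P k`: some sync words with symbols in the alphabets `X (P k)` and some
sequential decoders have an error probability that tends to zero. -/
def ErrorFreeSync (σ : ℝ) (X : ℝ → Set ℝ) (A N : ℕ → ℕ) (P : ℕ → ℝ) : Prop :=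
  ∃ (s : ∀ k, Fin (N k) → ℝ) (vhat : ∀ k, (Fin (A k + N k - 1) → ℝ) → Fin (A k)),
    (∀ k i, s k i ∈ X (P k)) ∧ (∀ k, IsSequentialDecoder (vhat k)) ∧
    Tendsto (fun k => syncErrorProb σ (s k) (vhat k)) atTop (𝓝 0)

/-- The interval length `A = e ^ (α E)` (rounded down to an integer) that belongs to the exponent
`α` and the sync packet energy `E`. -/
def intervalLength (α E : ℝ) : ℕ := ⌊Real.exp (α * E)⌋₊

/-- The exponents `α` that are achievable with the prescribed word lengths `N k` and symbol powers
`P k`: with `A k = e ^ (α E k)` and `E k = N k * P k`, error-free synchronisation is possible. -/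
def achievableExponentsAlong (σ : ℝ) (X : ℝ → Set ℝ) (N : ℕ → ℕ) (P : ℕ → ℝ) : Set ℝ :=
  {α | 0 < α ∧ ErrorFreeSync σ X (fun k => intervalLength α (N k * P k)) N P}

/-- The exponents `α` that are achievable with some choice of word lengths and symbol powers for
which the energy `N k * P k` tends to infinity. -/
def achievableExponents (σ : ℝ) (X : ℝ → Set ℝ) : Set ℝ :=
  {α | ∃ (N : ℕ → ℕ) (P : ℕ → ℝ), (∀ k, 1 ≤ N k) ∧ (∀ k, 0 < P k) ∧
    Tendsto (fun k => (N k : ℝ) * P k) atTop atTop ∧ α ∈ achievableExponentsAlong σ X N P}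

/-- `θ` is the synchronisation threshold with respect to the sync packet energy: the supremum of
the achievable exponents. -/
def IsEnergySyncThreshold (σ : ℝ) (X : ℝ → Set ℝ) (θ : ℝ) : Prop :=
  IsLUB (achievableExponents σ X) θ

/-- `θ` is the threshold for the prescribed word lengths `N k` and symbol powers `P k`. -/
def IsEnergySyncThresholdAlong (σ : ℝ) (X : ℝ → Set ℝ) (N : ℕ → ℕ) (P : ℕ → ℝ) (θ : ℝ) : Prop :=
  IsLUB (achievableExponentsAlong σ X N P) θ

end

open MeasureTheory ProbabilityTheory Filter Topology

/-! Direct part. The sync word has symbol `√P` on a set `S` of almost `N` positions, and the decoder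
declares the first start whose correlation with the output reaches a threshold. A start disjoint
from the true one triggers a false alarm with probability about `exp (-E / (2σ²))`, so `A` of them
are harmless when `A` is exponentially smaller than `exp (E / (2σ²))`. The fewer than `N`
overlapping starts need a word with a self-correlation deficit `d`: each errs with probability at
most `exp (-d² P / (8σ² N))`. The constant word has deficit only 1 at shift 1. Deleting a sparse
pattern of about `N^(2/3)` positions gives `d` of order `N^(2/3)`
(`exists_finset_autocorrelation_le`); the exponent is then of order `N^(1/3) P`, which beats `log N`
when `P` is bounded below. `syncErrorProb_onOffWord_le` collects these bounds.

Converse. Under pure noise the events `vhat = v` are disjoint, so their probabilities sum to at most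
1. Sending the word multiplies each by at most `exp g`, unless the log-likelihood ratio, a Gaussian
with mean at most `E / (2σ²)`, exceeds `g`. With `g` between that mean and `log A`, the average
probability of a correct decision vanishes (`one_sub_syncErrorProb_le`). -/

/-! ### Gaussian tails of linear statistics -/

instance isProbabilityMeasure_awgnOutput (σ : ℝ) {m : ℕ} (x : Fin m → ℝ) :
    IsProbabilityMeasure (awgnOutput σ x) := by
  unfold awgnOutput; infer_instance

theorem exp_sum_mul_eq_prod {m : ℕ} (a y : Fin m → ℝ) :
    Real.exp (∑ n, a n * y n) = ∏ n, Real.exp (a n * y n) := Real.exp_sum _ _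

theorem integrable_exp_awgnOutput (σ : ℝ) {m : ℕ} (x a : Fin m → ℝ) :
    Integrable (fun y : Fin m → ℝ => Real.exp (∑ n, a n * y n)) (awgnOutput σ x) := by
  simp_rw [exp_sum_mul_eq_prod]
  exact Integrable.fintype_prod fun n => integrable_exp_mul_gaussianReal (a n)

theorem integral_exp_awgnOutput (σ : ℝ) {m : ℕ} (x a : Fin m → ℝ) :
    ∫ y, Real.exp (∑ n, a n * y n) ∂(awgnOutput σ x) =
      Real.exp (∑ n, a n * x n + σ ^ 2 / 2 * ∑ n, a n ^ 2) := by
  simp_rw [exp_sum_mul_eq_prod]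
  unfold awgnOutput
  rw [integral_fintype_prod_eq_prod (fun n (t : ℝ) => Real.exp (a n * t)), Finset.mul_sum,
    ← Finset.sum_add_distrib, Real.exp_sum]
  refine Finset.prod_congr rfl fun n _ => ?_
  have h := congrFun (mgf_id_gaussianReal (μ := x n) (v := (σ ^ 2).toNNReal)) (a n)
  simp only [mgf, id] at h
  rw [h, Real.coe_toNNReal _ (sq_nonneg σ)]
  ring_nf

/-- Chernoff bound for a linear statistic of the channel output. -/
theorem awgnOutput_real_le_sum_le (σ : ℝ) {m : ℕ} (x a : Fin m → ℝ) (r : ℝ) {l : ℝ}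
    (hl : 0 ≤ l) :
    (awgnOutput σ x).real {y | r ≤ ∑ n, a n * y n} ≤
      Real.exp (-l * r + l * ∑ n, a n * x n + σ ^ 2 / 2 * l ^ 2 * ∑ n, a n ^ 2) := by
  have e : ∀ y : Fin m → ℝ, l * ∑ n, a n * y n = ∑ n, (l * a n) * y n := fun y => by
    rw [Finset.mul_sum]; exact Finset.sum_congr rfl fun n _ => by ring
  have hi : Integrable (fun y : Fin m → ℝ => Real.exp (l * ∑ n, a n * y n)) (awgnOutput σ x) := by
    simp_rw [e]; exact integrable_exp_awgnOutput σ x _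
  refine (measure_ge_le_exp_mul_mgf r hl hi).trans_eq ?_
  simp only [mgf, e]
  rw [integral_exp_awgnOutput, ← Real.exp_add, ← e]
  congr 1
  have : ∑ n, (l * a n) ^ 2 = l ^ 2 * ∑ n, a n ^ 2 := by
    rw [Finset.mul_sum]; exact Finset.sum_congr rfl fun n _ => by ring
  rw [this]; ring

/-- Upper Gaussian tail of a linear statistic of the channel output. -/
theorem awgnOutput_real_upper_tail {σ : ℝ} (hσ : 0 < σ) {m : ℕ} (x a : Fin m → ℝ) {r : ℝ}
    (hr : ∑ n, a n * x n ≤ r) :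
    (awgnOutput σ x).real {y | r ≤ ∑ n, a n * y n} ≤
      Real.exp (-(r - ∑ n, a n * x n) ^ 2 / (2 * σ ^ 2 * ∑ n, a n ^ 2)) := by
  have hq : 0 ≤ ∑ n, a n ^ 2 := Finset.sum_nonneg fun n _ => sq_nonneg _
  rcases hq.eq_or_lt with h0 | hpos
  -- For `a = 0` division by zero makes the bound `exp 0 = 1`.
  · rw [← h0]; simp
  set q := ∑ n, a n ^ 2
  set c := ∑ n, a n * x n
  -- This `l` minimises the Chernoff exponent `-l (r - c) + σ² l² q / 2`.
  refine (awgnOutput_real_le_sum_le σ x a r (l := (r - c) / (σ ^ 2 * q))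
    (div_nonneg (by linarith) (by positivity))).trans_eq ?_
  congr 1
  change -((r - c) / (σ ^ 2 * q)) * r + (r - c) / (σ ^ 2 * q) * c
    + σ ^ 2 / 2 * ((r - c) / (σ ^ 2 * q)) ^ 2 * q = _
  field_simp
  ring

/-- Lower Gaussian tail of a linear statistic of the channel output. -/
theorem awgnOutput_real_lower_tail {σ : ℝ} (hσ : 0 < σ) {m : ℕ} (x a : Fin m → ℝ) {r : ℝ}
    (hr : r ≤ ∑ n, a n * x n) :
    (awgnOutput σ x).real {y | ∑ n, a n * y n ≤ r} ≤
      Real.exp (-(∑ n, a n * x n - r) ^ 2 / (2 * σ ^ 2 * ∑ n, a n ^ 2)) := by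
  have h := awgnOutput_real_upper_tail hσ x (fun n => -a n) (r := -r)
    (by simpa using hr)
  simp only [neg_mul, Finset.sum_neg_distrib, neg_le_neg_iff, neg_sq] at h
  refine h.trans_eq ?_
  congr 3
  ring

/-! ### Change of measure to pure noise -/

theorem gaussianReal_eq_lintegral_exp (m : ℝ) {v : NNReal} (hv : v ≠ 0) {s : Set ℝ}
    (hs : MeasurableSet s) :
    gaussianReal m v s = ∫⁻ t in s, ENNReal.ofReal (Real.exp (m / v * t - m ^ 2 / (2 * v)))
      ∂(gaussianReal 0 v) := by
  rw [gaussianReal_apply m hv, gaussianReal_of_var_ne_zero 0 hv,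
    setLIntegral_withDensity_eq_setLIntegral_mul _ (measurable_gaussianPDF 0 v) (by fun_prop) hs]
  refine lintegral_congr fun t => ?_
  simp only [Pi.mul_apply, gaussianPDF]
  rw [← ENNReal.ofReal_mul (gaussianPDFReal_nonneg _ _ _)]
  congr 1
  have hv' : (v : ℝ) ≠ 0 := by exact_mod_cast hv
  rw [gaussianPDFReal, gaussianPDFReal,
    mul_assoc _ (Real.exp _) (Real.exp _), ← Real.exp_add]
  congr 2
  field_simp
  ring

/-- Density of the output for the input `x` with respect to pure noise. -/
theorem awgnOutput_eq_withDensity {σ : ℝ} (hσ : 0 < σ) {m : ℕ} (x : Fin m → ℝ) :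
    awgnOutput σ x = (awgnOutput σ (fun _ : Fin m => 0)).withDensity fun y =>
      ENNReal.ofReal (∏ n, Real.exp (x n / σ ^ 2 * y n - x n ^ 2 / (2 * σ ^ 2))) := by
  have hv : (σ ^ 2).toNNReal ≠ 0 := by
    rw [Ne, Real.toNNReal_eq_zero, not_le]; positivity
  have hc : (((σ ^ 2).toNNReal : NNReal) : ℝ) = σ ^ 2 := Real.coe_toNNReal _ (sq_nonneg σ)
  have hi : ∀ (n : Fin m), Integrable
      (fun t : ℝ => Real.exp (x n / σ ^ 2 * t - x n ^ 2 / (2 * σ ^ 2)))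
      (gaussianReal 0 (σ ^ 2).toNNReal) := fun n => by
    simp_rw [Real.exp_sub]
    exact (integrable_exp_mul_gaussianReal _).div_const _
  rw [awgnOutput]
  -- It suffices to compare both measures on boxes, where the density factorises over the slots.
  refine Measure.pi_eq fun s hs => ?_
  rw [withDensity_apply _ (MeasurableSet.univ_pi hs), awgnOutput, Measure.restrict_pi_pi,
    ← ofReal_integral_eq_lintegral_ofReal (Integrable.fintype_prod fun n => (hi n).restrict)
      (Eventually.of_forall fun y => Finset.prod_nonneg fun n _ => (Real.exp_pos _).le),
    integral_fintype_prod_eq_prod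
      (fun n (t : ℝ) => Real.exp (x n / σ ^ 2 * t - x n ^ 2 / (2 * σ ^ 2))),
    ENNReal.ofReal_prod_of_nonneg fun n _ => integral_nonneg fun t => (Real.exp_pos _).le]
  refine Finset.prod_congr rfl fun n _ => ?_
  rw [gaussianReal_eq_lintegral_exp _ hv (hs n), hc,
    ofReal_integral_eq_lintegral_ofReal (hi n).restrict
      (Eventually.of_forall fun t => (Real.exp_pos _).le)]

/-- Change of measure: up to a large deviation of the log-likelihood ratio, an event is at most
`exp g` times as likely for the input `x` as for pure noise. -/
theorem awgnOutput_real_le_exp_mul_add {σ : ℝ} (hσ : 0 < σ) {m : ℕ} (x : Fin m → ℝ)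
    {B : Set (Fin m → ℝ)} (hB : MeasurableSet B) (g : ℝ) :
    (awgnOutput σ x).real B ≤ Real.exp g * (awgnOutput σ (fun _ : Fin m => 0)).real B +
      (awgnOutput σ x).real {y | σ ^ 2 * g + (∑ n, x n ^ 2) / 2 ≤ ∑ n, x n * y n} := by
  -- `T` is where the log-likelihood ratio `(∑ x y - ∑ x² / 2) / σ²` is at least `g`; off `T` the
  -- density is below `exp g`.
  set T := {y : Fin m → ℝ | σ ^ 2 * g + (∑ n, x n ^ 2) / 2 ≤ ∑ n, x n * y n}
  have hT : MeasurableSet T := measurableSet_le (by fun_prop) (by fun_prop)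
  have hsub : B ⊆ (B \ T) ∪ T := fun y hy => by
    by_cases h : y ∈ T
    · exact Or.inr h
    · exact Or.inl ⟨hy, h⟩
  refine (measureReal_mono hsub).trans ((measureReal_union_le _ _).trans ?_)
  gcongr
  have key : awgnOutput σ x (B \ T) ≤
      ENNReal.ofReal (Real.exp g) * awgnOutput σ (fun _ : Fin m => 0) B := by
    rw [awgnOutput_eq_withDensity hσ x, withDensity_apply _ (hB.diff hT)]
    calc _ ≤ ∫⁻ _ in B \ T, ENNReal.ofReal (Real.exp g) ∂(awgnOutput σ (fun _ : Fin m => 0)) := by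
          refine setLIntegral_mono measurable_const fun y hy => ENNReal.ofReal_le_ofReal ?_
          rw [← Real.exp_sum, Real.exp_le_exp, Finset.sum_sub_distrib, ← Finset.sum_div]
          have h := hy.2
          simp only [T, Set.mem_ofPred_eq, not_le] at h
          have : ∑ n, x n / σ ^ 2 * y n = (∑ n, x n * y n) / σ ^ 2 := by
            rw [Finset.sum_div]; exact Finset.sum_congr rfl fun n _ => by ring
          rw [this]
          have h2 : (∑ n, x n * y n) / σ ^ 2 < (σ ^ 2 * g + (∑ n, x n ^ 2) / 2) / σ ^ 2 := by gcongr
          have h3 : (σ ^ 2 * g + (∑ n, x n ^ 2) / 2) / σ ^ 2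
              = g + (∑ n, x n ^ 2) / (2 * σ ^ 2) := by field_simp
          linarith
      _ ≤ _ := by
          rw [setLIntegral_const]
          gcongr
          exact Set.sdiff_subset
  have := ENNReal.toReal_mono (by finiteness) key
  rwa [ENNReal.toReal_mul, ENNReal.toReal_ofReal (Real.exp_pos _).le] at this

/-! ### Binary words with small autocorrelations -/

/-- The positions in `S` that a shift by `j` keeps in `S`. -/
def autocorrelation (S : Finset ℕ) (j : ℕ) : ℕ := (S.filter fun i => i + j ∈ S).card

/-- Each element of `S` that the shift moves out of `S` costs one coincidence, so a deficit is
proved by exhibiting a set `D` of such elements. -/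
theorem autocorrelation_add_le {S : Finset ℕ} {j d : ℕ} (D : Finset ℕ) (hd : d ≤ D.card)
    (hD : ∀ i ∈ D, i ∈ S ∧ i + j ∉ S) : autocorrelation S j + d ≤ S.card := by
  have h := Finset.card_filter_add_card_filter_not (s := S) fun i => i + j ∈ S
  have : D.card ≤ (S.filter fun i => ¬ (i + j ∈ S)).card :=
    Finset.card_le_card fun i hi => Finset.mem_filter.2 (hD i hi)
  unfold autocorrelation
  omega

theorem autocorrelation_range {N j : ℕ} (hN : 1 ≤ N) (hj : 1 ≤ j) :
    autocorrelation (Finset.range N) j + 1 ≤ (Finset.range N).card :=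
  autocorrelation_add_le {N - 1} (by simp) (by simp; omega)

/-- All positions below `N`, except the multiples of `b` in `[0, 4 b³)` and the multiples of
`b + 1` in `[4 b³, 8 b³)`. -/
def combSet (b N : ℕ) : Finset ℕ :=
  (Finset.range N).filter fun i =>
    ¬ (i < 4 * b ^ 3 ∧ b ∣ i) ∧ ¬ (4 * b ^ 3 ≤ i ∧ i < 8 * b ^ 3 ∧ b + 1 ∣ i)

/-- The two families of deleted multiples have at most `4 b²` and `8 b²` members. With `b` of order
`N^(1/3)` this is negligible against `N`. -/
theorem le_card_combSet (b N : ℕ) : N ≤ (combSet b N).card + 12 * b ^ 2 := by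
  have hsub : Finset.range N ⊆ combSet b N ∪
      ((Finset.range (4 * b ^ 2)).image (fun m => b * m) ∪
        (Finset.range (8 * b ^ 2)).image (fun m => (b + 1) * m)) := by
    intro i hi
    simp only [combSet, Finset.mem_union, Finset.mem_filter, hi, true_and, Finset.mem_image,
      Finset.mem_range]
    by_contra! h
    obtain ⟨h1, h2, h3⟩ := h
    by_cases h4 : i < 4 * b ^ 3 ∧ b ∣ i
    · obtain ⟨h4, m, rfl⟩ := h4
      refine h2 m ?_ rfl
      by_contra! h5
      nlinarith [Nat.mul_le_mul_left b h5]
    · obtain ⟨-, h6, m, rfl⟩ := h1 (not_and.1 h4)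
      refine h3 m ?_ rfl
      by_contra! h5
      nlinarith [Nat.mul_le_mul_left (b + 1) h5]
  have h := (Finset.card_le_card hsub).trans (Finset.card_union_le _ _)
  have h' := Finset.card_union_le ((Finset.range (4 * b ^ 2)).image (fun m => b * m))
    ((Finset.range (8 * b ^ 2)).image (fun m => (b + 1) * m))
  have h1 := Finset.card_image_le (s := Finset.range (4 * b ^ 2)) (f := fun m => b * m)
  have h2 := Finset.card_image_le (s := Finset.range (8 * b ^ 2)) (f := fun m => (b + 1) * m)
  simp only [Finset.card_range] at h h1 h2
  omega

/-- A shift moves many ones onto the multiples of `q` in `[a, a + L)`, if these are the only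
positions of that interval outside of `S`, and `q` does not divide the shift. -/
theorem autocorrelation_add_le_of_not_dvd {S : Finset ℕ} {a L q j d : ℕ} (hq : 1 ≤ q)
    (hS : ∀ i, a ≤ i → i < a + L → (i ∈ S ↔ ¬ q ∣ i)) (hj : ¬ q ∣ j) (hL : j + q * d ≤ L) :
    autocorrelation S j + d ≤ S.card := by
  set m₀ := (a + j + (q - 1)) / q
  -- `q * m₀` is the first multiple of `q` from `a + j` on. The `d` multiples starting there are the
  -- gaps that get hit, from positions that are no multiples since `q` does not divide `j`.
  have hm1 : a + j ≤ q * m₀ := by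
    have := Nat.lt_mul_div_succ (a + j + (q - 1)) (by omega : 0 < q)
    rw [mul_add] at this
    change _ < q * m₀ + q * 1 at this
    omega
  have hm2 : q * m₀ ≤ a + j + (q - 1) := Nat.mul_div_le _ _
  refine autocorrelation_add_le ((Finset.range d).image fun m => q * (m₀ + m) - j) ?_ ?_
  · rw [Finset.card_image_of_injOn, Finset.card_range]
    intro m _ m' _ h
    have e1 : q * (m₀ + m) = q * m₀ + q * m := mul_add _ _ _
    have e2 : q * (m₀ + m') = q * m₀ + q * m' := mul_add _ _ _
    have h3 : q * m = q * m' := by simp only at h; omega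
    exact Nat.eq_of_mul_eq_mul_left (by omega) h3
  · intro i hi
    obtain ⟨m, hm, rfl⟩ := Finset.mem_image.1 hi
    have hm := Finset.mem_range.1 hm
    have e1 : q * (m₀ + m) = q * m₀ + q * m := mul_add _ _ _
    have e2 : q * (m + 1) ≤ q * d := Nat.mul_le_mul_left _ hm
    have e3 : q * (m + 1) = q * m + q := by ring
    have hz : q * (m₀ + m) < a + L := by omega
    have hsum : q * (m₀ + m) - j + j = q * (m₀ + m) := by omega
    constructor
    · rw [hS _ (by omega) (by omega)]
      intro hdvd
      apply hj
      have : q ∣ q * (m₀ + m) - j + j := by rw [hsum]; exact dvd_mul_right _ _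
      exact (Nat.dvd_add_right hdvd).1 this
    · rw [hsum, hS _ (by omega) hz, not_not]
      exact dvd_mul_right _ _

/-- A shift of at least `b (b + 1)` pushes the last `b²` positions beyond `N`. A smaller nonzero
shift cannot be divisible by both coprime numbers `b` and `b + 1`, so one of the two combs detects
it. -/
theorem autocorrelation_combSet {b N j : ℕ} (hb : 2 ≤ b) (hN : 16 * b ^ 3 ≤ N) (hj : 1 ≤ j) :
    autocorrelation (combSet b N) j + b ^ 2 ≤ (combSet b N).card := by
  have hb2 : b ^ 2 = b * b := by ring
  have hb3 : 2 * b ^ 2 ≤ b ^ 3 := by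
    rw [pow_succ b 2, mul_comm]; exact Nat.mul_le_mul_left _ hb
  have hbb : 2 * b ≤ b ^ 2 := by rw [hb2]; exact Nat.mul_le_mul_right _ hb
  by_cases hlarge : b * (b + 1) ≤ j
  · refine autocorrelation_add_le (Finset.Ico (N - b ^ 2) N) ?_ ?_
    · rw [Nat.card_Ico]; omega
    · intro i hi
      rw [Finset.mem_Ico] at hi
      have e : b * (b + 1) = b ^ 2 + b := by ring
      simp only [combSet, Finset.mem_filter, Finset.mem_range]
      omega
  have e1 : b * (b + 1) = b ^ 2 + b := by ring
  have e2 : b * b ^ 2 = b ^ 3 := by ring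
  have e3 : (b + 1) * b ^ 2 = b ^ 3 + b ^ 2 := by ring
  by_cases hdvd : b ∣ j
  · have hdvd' : ¬ b + 1 ∣ j := fun h => by
      have := Nat.le_of_dvd hj
        (Nat.Coprime.mul_dvd_of_dvd_of_dvd (Nat.coprime_self_add_right.2 (by simp)) hdvd h)
      omega
    refine autocorrelation_add_le_of_not_dvd (a := 4 * b ^ 3) (L := 4 * b ^ 3) (by omega) ?_
      hdvd' (by omega)
    intro i hi hi'
    simp only [combSet, Finset.mem_filter, Finset.mem_range]
    constructor
    · intro h hd; exact h.2.2 ⟨hi, by omega, hd⟩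
    · intro h; exact ⟨by omega, by omega, fun h' => h h'.2.2⟩
  · refine autocorrelation_add_le_of_not_dvd (a := 0) (L := 4 * b ^ 3) (by omega) ?_
      hdvd (by omega)
    intro i hi hi'
    simp only [combSet, Finset.mem_filter, Finset.mem_range]
    constructor
    · intro h hd; exact h.2.1 ⟨by omega, hd⟩
    · intro h; exact ⟨by omega, fun h' => h h'.2, by omega⟩

/-- Binary words of every length with almost full weight, and with autocorrelations at nonzero
shifts that fall short of the weight by at least the order of `N ^ (2 / 3)`. -/
theorem exists_finset_autocorrelation_le {η : ℝ} (hη : 0 < η) :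
    ∃ c : ℝ, 0 < c ∧ c ≤ η ∧ ∀ N : ℕ, 1 ≤ N → ∃ S ⊆ Finset.range N,
      (1 - η) * N ≤ S.card ∧
      ∀ j, 1 ≤ j → (autocorrelation S j : ℝ) + c * (N : ℝ) ^ (2 / 3 : ℝ) ≤ S.card := by
  obtain ⟨b₀, hb₀⟩ : ∃ b₀ : ℕ, b₀ = ⌈1 / η⌉₊ + 2 := ⟨_, rfl⟩
  obtain ⟨N₀, hN₀_eq⟩ : ∃ N₀ : ℕ, N₀ = 16 * b₀ ^ 3 := ⟨_, rfl⟩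
  have hN₀ : 128 ≤ N₀ := by
    have : 2 ^ 3 ≤ b₀ ^ 3 := Nat.pow_le_pow_left (by omega) 3
    omega
  have hN₀' : (128 : ℝ) ≤ N₀ := by exact_mod_cast hN₀
  refine ⟨min (1 / N₀) η, lt_min (by positivity) hη, min_le_right _ _, fun N hN => ?_⟩
  have hN1 : (1 : ℝ) ≤ N := by exact_mod_cast hN
  have hc : min (1 / (N₀ : ℝ)) η * (N : ℝ) ^ (2 / 3 : ℝ) ≤ (N : ℝ) ^ (2 / 3 : ℝ) / N₀ := by
    exact (mul_le_mul_of_nonneg_right (min_le_left _ _) (by positivity)).trans_eq (by ring)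
  by_cases hlt : N < N₀
  -- For the finitely many short lengths the constant word does: its deficit 1 suffices because `c ≤
  -- 1 / N₀`.
  · refine ⟨Finset.range N, subset_rfl, ?_, fun j hj => ?_⟩
    · rw [Finset.card_range]; nlinarith
    · have h := autocorrelation_range hN hj
      have h' : (autocorrelation (Finset.range N) j : ℝ) + 1 ≤ (Finset.range N).card := by
        exact_mod_cast h
      have : (N : ℝ) ^ (2 / 3 : ℝ) / N₀ ≤ 1 := by
        rw [div_le_one (by linarith)]
        calc (N : ℝ) ^ (2 / 3 : ℝ) ≤ (N : ℝ) ^ (1 : ℝ) :=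
              Real.rpow_le_rpow_of_exponent_le hN1 (by norm_num)
          _ = N := Real.rpow_one _
          _ ≤ N₀ := by exact_mod_cast hlt.le
      linarith
  -- Take the largest `b` with `16 b³ ≤ N`. Then `N ≤ 128 b³`, so `b²` is at least `N^(2/3) / 128`,
  -- while `η b ≥ 1` makes the `12 b²` deletions at most `η N`.
  · push Not at hlt
    obtain ⟨b, hb1, hb2⟩ : ∃ b, 16 * b ^ 3 ≤ N ∧ N < 16 * (b + 1) ^ 3 := by
      have hex : ∃ b, N < 16 * (b + 1) ^ 3 :=
        ⟨N, by nlinarith [Nat.le_self_pow (n := 3) (by norm_num) (N + 1)]⟩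
      refine ⟨Nat.find hex, ?_, Nat.find_spec hex⟩
      rcases h : Nat.find hex with _ | m
      · simp
      · have := Nat.find_min hex (m := m) (by omega)
        omega
    have hbb : b₀ ≤ b := by
      by_contra! h
      have : (b + 1) ^ 3 ≤ b₀ ^ 3 := Nat.pow_le_pow_left h 3
      omega
    have hb : 2 ≤ b := by omega
    have hbη : 1 ≤ η * b := by
      have h1 : 1 / η ≤ b := (Nat.le_ceil _).trans (by exact_mod_cast (by omega : ⌈1 / η⌉₊ ≤ b))
      rwa [div_le_iff₀ hη, mul_comm] at h1
    refine ⟨combSet b N, Finset.filter_subset _ _, ?_, fun j hj => ?_⟩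
    · have h := le_card_combSet b N
      have h' : (N : ℝ) ≤ (combSet b N).card + 12 * (b : ℝ) ^ 2 := by exact_mod_cast h
      have hb1' : 16 * (b : ℝ) ^ 3 ≤ N := by exact_mod_cast hb1
      have h3 : (b : ℝ) ^ 2 * 1 ≤ (b : ℝ) ^ 2 * (η * b) := by gcongr
      have h4 : η * (16 * (b : ℝ) ^ 3) ≤ η * N := by gcongr
      nlinarith [sq_nonneg (b : ℝ)]
    · have h := autocorrelation_combSet hb hb1 hj
      have h' : (autocorrelation (combSet b N) j : ℝ) + (b : ℝ) ^ 2 ≤ (combSet b N).card := by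
        exact_mod_cast h
      have hN8 : (N : ℝ) ≤ 128 * (b : ℝ) ^ 3 := by
        have : (b + 1) ^ 3 ≤ (2 * b) ^ 3 := Nat.pow_le_pow_left (by omega) 3
        have : N ≤ 128 * b ^ 3 := by rw [mul_pow] at this; omega
        exact_mod_cast this
      have : (N : ℝ) ^ (2 / 3 : ℝ) ≤ 128 * (b : ℝ) ^ 2 := by
        calc (N : ℝ) ^ (2 / 3 : ℝ) ≤ (128 * (b : ℝ) ^ 3) ^ (2 / 3 : ℝ) := by gcongr
          _ = 128 ^ (2 / 3 : ℝ) * ((b : ℝ) ^ 3) ^ (2 / 3 : ℝ) :=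
              Real.mul_rpow (by norm_num) (by positivity)
          _ ≤ 128 ^ (1 : ℝ) * (b : ℝ) ^ 2 := by
              gcongr ?_ * ?_
              · exact Real.rpow_le_rpow_of_exponent_le (by norm_num) (by norm_num)
              · rw [← Real.rpow_natCast, ← Real.rpow_mul (by positivity)]
                norm_num
          _ = _ := by rw [Real.rpow_one]
      have h5 : (N : ℝ) ^ (2 / 3 : ℝ) / N₀ ≤ (b : ℝ) ^ 2 := by
        rw [div_le_iff₀ (by linarith)]
        nlinarith [sq_nonneg (b : ℝ)]
      linarith

/-! ### The sequential threshold decoder -/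

/-- The correlation of the output with the sync word, placed at slot `u`. -/
def correlation {A N : ℕ} (s : Fin N → ℝ) (u : Fin A) (y : Fin (A + N - 1) → ℝ) : ℝ :=
  ∑ n, channelInput s u n * y n

open Classical in
/-- The decoder that declares the first slot at which the correlation reaches `r`, and the last
slot if there is none. -/
noncomputable def thresholdDecoder {A N : ℕ} (hA : 1 ≤ A) (s : Fin N → ℝ) (r : ℝ)
    (y : Fin (A + N - 1) → ℝ) : Fin A :=
  if h : ∃ t : ℕ, ∃ ht : t < A, r ≤ correlation s ⟨t, ht⟩ y then ⟨Nat.find h, (Nat.find_spec h).1⟩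
  else ⟨A - 1, by omega⟩

/-- Only correlations at starts up to `t` enter, which makes the decoder sequential. The alternative
`t + 1 = A` is the default: the last slot is declared whenever no earlier one was. -/
theorem thresholdDecoder_eq_iff {A N : ℕ} (hA : 1 ≤ A) (s : Fin N → ℝ) (r : ℝ)
    (y : Fin (A + N - 1) → ℝ) (t : Fin A) :
    thresholdDecoder hA s r y = t ↔
      (t.val + 1 = A ∨ r ≤ correlation s t y) ∧ ∀ u : Fin A, u < t → correlation s u y < r := by
  unfold thresholdDecoder
  split_ifs with h
  · rw [Fin.ext_iff, Nat.find_eq_iff]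
    constructor
    · rintro ⟨⟨_, h1⟩, h2⟩
      refine ⟨Or.inr h1, fun u hu => ?_⟩
      have := h2 u hu
      push Not at this
      exact this u.2
    · rintro ⟨h1, h2⟩
      refine ⟨⟨t.2, ?_⟩, fun m hm => ?_⟩
      · rcases h1 with h1 | h1
        · obtain ⟨u, hu, hr⟩ := h
          rcases lt_or_ge u t.val with hlt | hge
          · exact absurd hr (not_le.2 (h2 ⟨u, hu⟩ hlt))
          · have : (⟨u, hu⟩ : Fin A) = t := Fin.ext (by simp only; omega)
            rwa [this] at hr
        · exact h1
      · rintro ⟨hmA, hr⟩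
        exact absurd hr (not_le.2 (h2 ⟨m, hmA⟩ hm))
  · push Not at h
    constructor
    · rintro rfl
      exact ⟨Or.inl (by simp only; omega), fun u _ => h u u.2⟩
    · rintro ⟨h1 | h1, -⟩
      · exact Fin.ext (by simp only; omega)
      · exact absurd h1 (not_le.2 (h t t.2))

theorem measurable_correlation {A N : ℕ} (s : Fin N → ℝ) (u : Fin A) :
    Measurable (correlation s u) := by
  unfold correlation; fun_prop

theorem correlation_congr {A N : ℕ} (s : Fin N → ℝ) (u : Fin A) {y y' : Fin (A + N - 1) → ℝ}
    (h : ∀ n, n.val < u.val + N → y n = y' n) : correlation s u y = correlation s u y' := by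
  refine Finset.sum_congr rfl fun n _ => ?_
  by_cases hn : n.val < u.val + N
  · rw [h n hn]
  · rw [channelInput, dif_neg (by omega), zero_mul, zero_mul]

theorem isSequentialDecoder_thresholdDecoder {A N : ℕ} (hA : 1 ≤ A) (s : Fin N → ℝ) (r : ℝ) :
    IsSequentialDecoder (thresholdDecoder hA s r) := by
  intro t
  constructor
  · simp_rw [thresholdDecoder_eq_iff]
    refine MeasurableSet.inter (MeasurableSet.union (MeasurableSet.const _) ?_) ?_
    · exact measurableSet_le measurable_const (measurable_correlation s t)
    · have : {y : Fin (A + N - 1) → ℝ | ∀ u : Fin A, u < t → correlation s u y < r} =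
          ⋂ u : Fin A, ⋂ _ : u < t, {y | correlation s u y < r} := by
        ext y; simp
      change MeasurableSet {y : Fin (A + N - 1) → ℝ | ∀ u : Fin A, u < t → correlation s u y < r}
      rw [this]
      exact MeasurableSet.iInter fun u => MeasurableSet.iInter fun _ =>
        measurableSet_lt (measurable_correlation s u) measurable_const
  · intro y y' h
    rw [thresholdDecoder_eq_iff, thresholdDecoder_eq_iff, correlation_congr s t h]
    refine and_congr_right fun _ => forall_congr' fun u => ?_
    refine imp_congr_right fun hu => ?_
    rw [correlation_congr s u fun n hn => h n (by have : u.val < t.val := hu; omega)]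

/-- Union bound for the threshold decoder. -/
theorem awgnOutput_real_thresholdDecoder_ne_le (σ : ℝ) {A N : ℕ} (hA : 1 ≤ A) (s : Fin N → ℝ)
    (r : ℝ) (v : Fin A) :
    (awgnOutput σ (channelInput s v)).real {y | thresholdDecoder hA s r y ≠ v} ≤
      (awgnOutput σ (channelInput s v)).real {y | correlation s v y ≤ r} +
        ∑ u ∈ Finset.Iio v,
          (awgnOutput σ (channelInput s v)).real {y | r ≤ correlation s u y} := by
  have hsub : {y | thresholdDecoder hA s r y ≠ v} ⊆ {y | correlation s v y ≤ r} ∪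
      ⋃ u ∈ Finset.Iio v, {y | r ≤ correlation s u y} := by
    intro y hy
    by_contra hcon
    simp only [Set.mem_union, Set.mem_iUnion, Set.mem_ofPred_eq, Finset.mem_Iio, not_or, not_le,
      not_exists] at hcon
    exact hy ((thresholdDecoder_eq_iff hA s r y v).2 ⟨Or.inr hcon.1.le, hcon.2⟩)
  refine (measureReal_mono hsub).trans ((measureReal_union_le _ _).trans ?_)
  gcongr
  exact measureReal_biUnion_finset_le _ _

/-! ### Error probability of on-off words -/

/-- The word with power `P` in the positions of `S`, and zeros elsewhere. -/
noncomputable def onOffWord (N : ℕ) (S : Finset ℕ) (P : ℝ) (i : Fin N) : ℝ :=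
  if i.val ∈ S then Real.sqrt P else 0

theorem channelInput_onOffWord {A N : ℕ} {S : Finset ℕ} (hS : S ⊆ Finset.range N) (P : ℝ)
    (v : Fin A) (n : Fin (A + N - 1)) :
    channelInput (onOffWord N S P) v n =
      if v.val ≤ n.val ∧ n.val - v.val ∈ S then Real.sqrt P else 0 := by
  unfold channelInput onOffWord
  by_cases h : v.val ≤ n.val ∧ n.val < v.val + N
  · rw [dif_pos h]; simp [h.1]
  · rw [dif_neg h, if_neg]
    rintro ⟨h1, h2⟩
    have := Finset.mem_range.1 (hS h2)
    omega

/-- This inner product is the mean correlation at `u` when the true start is `v`. The case `u ≤ v`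
suffices, as false alarms only matter before `v`. -/
theorem sum_channelInput_onOffWord_mul {A N : ℕ} {S : Finset ℕ} (hS : S ⊆ Finset.range N)
    {P : ℝ} (hP : 0 ≤ P) {u v : Fin A} (huv : u ≤ v) :
    ∑ n, channelInput (onOffWord N S P) u n * channelInput (onOffWord N S P) v n =
      P * autocorrelation S (v.val - u.val) := by
  have huv' : u.val ≤ v.val := huv
  simp_rw [channelInput_onOffWord hS]
  have : ∀ n : Fin (A + N - 1),
      (if u.val ≤ n.val ∧ n.val - u.val ∈ S then Real.sqrt P else 0) *
        (if v.val ≤ n.val ∧ n.val - v.val ∈ S then Real.sqrt P else 0) =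
      if v.val ≤ n.val ∧ n.val - v.val ∈ S ∧ n.val - u.val ∈ S then P else 0 := by
    intro n
    by_cases h1 : v.val ≤ n.val <;> by_cases h2 : n.val - v.val ∈ S <;>
      by_cases h3 : n.val - u.val ∈ S <;> simp [h1, h2, h3, hP]
    omega
  simp_rw [this]
  rw [← Finset.sum_filter, Finset.sum_const, nsmul_eq_mul, mul_comm, autocorrelation]
  congr 2
  refine Finset.card_bij (fun n _ => n.val - v.val) ?_ ?_ ?_
  · intro n hn
    obtain ⟨h1, h2, h3⟩ := (Finset.mem_filter.1 hn).2
    refine Finset.mem_filter.2 ⟨h2, ?_⟩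
    rwa [show n.val - v.val + (v.val - u.val) = n.val - u.val by omega]
  · intro n hn n' hn' h
    have h1 := (Finset.mem_filter.1 hn).2.1
    have h2 := (Finset.mem_filter.1 hn').2.1
    exact Fin.ext (by omega)
  · intro i hi
    obtain ⟨h1, h2⟩ := Finset.mem_filter.1 hi
    have hiN := Finset.mem_range.1 (hS h1)
    have hv := v.2
    refine ⟨⟨i + v.val, by omega⟩, Finset.mem_filter.2 ⟨Finset.mem_univ _, ?_⟩, by simp⟩
    refine ⟨by simp, by simpa using h1, ?_⟩
    simp only
    rwa [show i + v.val - u.val = i + (v.val - u.val) by omega]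

theorem autocorrelation_zero (S : Finset ℕ) : autocorrelation S 0 = S.card := by
  simp [autocorrelation]

theorem autocorrelation_eq_zero {S : Finset ℕ} {N j : ℕ} (hS : S ⊆ Finset.range N) (hj : N ≤ j) :
    autocorrelation S j = 0 := by
  rw [autocorrelation, Finset.card_eq_zero, Finset.filter_eq_empty_iff]
  intro i _ h
  have := Finset.mem_range.1 (hS h)
  omega

theorem sum_channelInput_onOffWord_sq {A N : ℕ} {S : Finset ℕ} (hS : S ⊆ Finset.range N)
    {P : ℝ} (hP : 0 ≤ P) (u : Fin A) :
    ∑ n, channelInput (onOffWord N S P) u n ^ 2 = P * S.card := by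
  have h := sum_channelInput_onOffWord_mul hS hP (le_refl u)
  simpa [sq, autocorrelation_zero] using h

/-- Error probability of the threshold decoder for an on-off word whose autocorrelations fall short
of its weight by `d`. -/
theorem syncErrorProb_onOffWord_le {σ : ℝ} (hσ : 0 < σ) {A N : ℕ} (hA : 1 ≤ A) {S : Finset ℕ}
    (hS : S ⊆ Finset.range N) {P : ℝ} (hP : 0 < P) {d : ℝ} (hd : 0 ≤ d)
    (hac : ∀ j, 1 ≤ j → (autocorrelation S j : ℝ) + d ≤ S.card) :
    syncErrorProb σ (onOffWord N S P) (thresholdDecoder hA (onOffWord N S P) ((S.card - d / 2) * P))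
      ≤ (N + 1) * Real.exp (-(d ^ 2 * P / (8 * σ ^ 2 * N))) +
        A * Real.exp (-((S.card - d) * P / (2 * σ ^ 2))) := by
  set s := onOffWord N S P
  set w : ℝ := (S.card : ℝ)
  set near := Real.exp (-(d ^ 2 * P / (8 * σ ^ 2 * N)))
  set far := Real.exp (-((w - d) * P / (2 * σ ^ 2)))
  have hdw : d ≤ w := by
    have := hac 1 le_rfl
    have h0 : (0 : ℝ) ≤ autocorrelation S 1 := by positivity
    linarith
  have hw : w ≤ N := by
    have := Finset.card_le_card hS
    rw [Finset.card_range] at this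
    exact Nat.cast_le.2 this
  have hA' : (0 : ℝ) < A := by exact_mod_cast hA
  -- The threshold lies midway between the mean `w P` at the true start and the largest possible
  -- mean `(w - d) P` elsewhere, hence the margin `d P / 2` for misses and false alarms alike.
  have hexp_near : ∀ g : ℝ, d * P / 2 ≤ g →
      Real.exp (-g ^ 2 / (2 * σ ^ 2 * (P * w))) ≤ near := by
    intro g hg
    rcases (hd.trans hdw).eq_or_lt with hw0 | hwpos
    · have : d = 0 := le_antisymm (by rw [hw0]; exact hdw) hd
      simp [near, this, ← hw0]
    · refine Real.exp_le_exp.2 ?_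
      rw [neg_div, neg_le_neg_iff]
      calc d ^ 2 * P / (8 * σ ^ 2 * N) ≤ d ^ 2 * P / (8 * σ ^ 2 * w) := by gcongr
        _ = (d * P / 2) ^ 2 / (2 * σ ^ 2 * (P * w)) := by field_simp; ring
        _ ≤ _ := by gcongr
  have hmiss : ∀ v : Fin A, (awgnOutput σ (channelInput s v)).real
      {y | correlation s v y ≤ (w - d / 2) * P} ≤ near := by
    intro v
    have hm : ∑ n, channelInput s v n * channelInput s v n = P * w := by
      have := sum_channelInput_onOffWord_mul hS hP.le (le_refl v)
      rwa [Nat.sub_self, autocorrelation_zero] at this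
    refine (awgnOutput_real_lower_tail hσ (channelInput s v) (channelInput s v) ?_).trans ?_
    · rw [hm]; nlinarith
    · rw [hm, sum_channelInput_onOffWord_sq hS hP.le v]
      exact hexp_near _ (by linarith)
  have hfalse : ∀ u v : Fin A, u < v → (awgnOutput σ (channelInput s v)).real
      {y | (w - d / 2) * P ≤ correlation s u y} ≤
        (if v.val < u.val + N then near else 0) + far := by
    intro u v huv
    have huv' : u.val < v.val := huv
    have hm := sum_channelInput_onOffWord_mul hS hP.le huv.le
    have hj := hac (v.val - u.val) (by omega)
    refine (awgnOutput_real_upper_tail hσ (channelInput s v) (channelInput s u) ?_).trans ?_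
    · rw [hm]; nlinarith
    · rw [hm, sum_channelInput_onOffWord_sq hS hP.le u]
      split_ifs with hn
      · have hf : 0 ≤ far := (Real.exp_pos _).le
        refine (hexp_near _ ?_).trans (by linarith)
        nlinarith
      · rw [zero_add, autocorrelation_eq_zero hS (by omega), Nat.cast_zero, mul_zero, sub_zero]
        rcases (hd.trans hdw).eq_or_lt with hw0 | hwpos
        · have : d = 0 := le_antisymm (by rw [hw0]; exact hdw) hd
          simp [far, this, ← hw0]
        · refine Real.exp_le_exp.2 ?_
          change _ / (2 * σ ^ 2 * (P * w)) ≤ _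
          rw [neg_div, neg_le_neg_iff]
          have h1 : ((w - d / 2) * P) ^ 2 / (2 * σ ^ 2 * (P * w)) =
              ((w - d / 2) ^ 2 / w) * P / (2 * σ ^ 2) := by field_simp
          rw [h1]
          gcongr
          -- `(w - d / 2)² = w (w - d) + d² / 4`.
          rw [le_div_iff₀ hwpos]
          nlinarith [sq_nonneg d]
  have hv : ∀ v : Fin A, (awgnOutput σ (channelInput s v)).real
      {y | thresholdDecoder hA s ((w - d / 2) * P) y ≠ v} ≤ (N + 1) * near + A * far := by
    intro v
    refine (awgnOutput_real_thresholdDecoder_ne_le σ hA s _ v).trans ?_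
    have hsum : ∑ u ∈ Finset.Iio v, (awgnOutput σ (channelInput s v)).real
        {y | (w - d / 2) * P ≤ correlation s u y} ≤ N * near + A * far := by
      refine (Finset.sum_le_sum fun u hu => hfalse u v (Finset.mem_Iio.1 hu)).trans ?_
      rw [Finset.sum_add_distrib, ← Finset.sum_filter, Finset.sum_const, Finset.sum_const,
        nsmul_eq_mul, nsmul_eq_mul]
      -- Only starts less than `N` before `v` overlap the word; they are counted by their distance
      -- to `v`.
      have hc1 : ((Finset.Iio v).filter fun u : Fin A => v.val < u.val + N).card ≤ N := by
        have : (((Finset.Iio v).filter fun u : Fin A => v.val < u.val + N).image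
            fun u => v.val - u.val).card ≤ N := by
          refine (Finset.card_le_card (t := Finset.Icc 1 N) fun i hi => ?_).trans_eq (by simp)
          obtain ⟨u, hu, rfl⟩ := Finset.mem_image.1 hi
          obtain ⟨h1, h2⟩ := Finset.mem_filter.1 hu
          have h3 : u < v := Finset.mem_Iio.1 h1
          rw [Fin.lt_def] at h3
          rw [Finset.mem_Icc]; omega
        rwa [Finset.card_image_of_injOn] at this
        intro u hu u' hu' h
        have h1 : u < v := Finset.mem_Iio.1 (Finset.mem_filter.1 hu).1
        have h2 : u' < v := Finset.mem_Iio.1 (Finset.mem_filter.1 hu').1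
        exact Fin.ext (by simp only [Fin.lt_def] at h h1 h2; omega)
      have hc2 : (Finset.Iio v).card ≤ A := by
        simp
      gcongr
    linarith [hmiss v]
  rw [syncErrorProb, div_le_iff₀ hA']
  refine (Finset.sum_le_sum fun v _ => hv v).trans ?_
  rw [Finset.sum_const, nsmul_eq_mul, Finset.card_univ, Fintype.card_fin, mul_comm]

/-! ### Converse -/

theorem sum_channelInput_sq_le {A N : ℕ} {s : Fin N → ℝ} {P : ℝ} (hs : ∀ i, s i ^ 2 ≤ P)
    (hP : 0 ≤ P) (v : Fin A) : ∑ n, channelInput s v n ^ 2 ≤ N * P := by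
  have h : ∀ n : Fin (A + N - 1),
      channelInput s v n ^ 2 ≤ if v.val ≤ n.val ∧ n.val < v.val + N then P else 0 := by
    intro n
    unfold channelInput
    split_ifs
    · exact hs _
    · simp
  refine (Finset.sum_le_sum fun n _ => h n).trans ?_
  rw [← Finset.sum_filter, Finset.sum_const, nsmul_eq_mul]
  gcongr
  rw [← Finset.card_image_of_injective _ Fin.val_injective]
  refine (Finset.card_le_card (t := Finset.Ico v.val (v.val + N)) fun i hi => ?_).trans_eq (by simp)
  obtain ⟨n, hn, rfl⟩ := Finset.mem_image.1 hi
  exact Finset.mem_Ico.2 (Finset.mem_filter.1 hn).2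

/-- Every decoder errs often when the energy `E` of the sync word is small. -/
theorem one_sub_syncErrorProb_le {σ : ℝ} (hσ : 0 < σ) {A N : ℕ} (hA : 1 ≤ A) {s : Fin N → ℝ}
    {E : ℝ} (hE : ∀ v : Fin A, ∑ n, channelInput s v n ^ 2 ≤ E)
    {vhat : (Fin (A + N - 1) → ℝ) → Fin A} (hv : ∀ t, MeasurableSet {y | vhat y = t})
    (g : ℝ) {l : ℝ} (hl : 0 ≤ l) :
    1 - syncErrorProb σ s vhat ≤
      Real.exp g / A + Real.exp (-l * g + (l + l ^ 2) * (E / (2 * σ ^ 2))) := by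
  have hA' : (0 : ℝ) < A := by exact_mod_cast hA
  set tail := Real.exp (-l * g + (l + l ^ 2) * (E / (2 * σ ^ 2)))
  set μ₀ := awgnOutput σ (fun _ : Fin (A + N - 1) => 0)
  have hcorrect : ∀ v : Fin A, 1 - (awgnOutput σ (channelInput s v)).real {y | vhat y ≠ v} ≤
      Real.exp g * μ₀.real {y | vhat y = v} + tail := by
    intro v
    have hc : (awgnOutput σ (channelInput s v)).real {y | vhat y ≠ v} =
        1 - (awgnOutput σ (channelInput s v)).real {y | vhat y = v} :=
      probReal_compl_eq_one_sub (hv v)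
    rw [hc, sub_sub_cancel]
    refine (awgnOutput_real_le_exp_mul_add hσ _ (hv v) g).trans ?_
    gcongr
    -- Under the input `x` the log-likelihood ratio is Gaussian with mean `∑ x² / (2σ²)` and
    -- variance `∑ x² / σ²`. Dividing `l` by `σ²` makes this its Chernoff bound with parameter `l`.
    refine (awgnOutput_real_le_sum_le σ _ _ _ (l := l / σ ^ 2) (by positivity)).trans ?_
    have hq : ∑ n, channelInput s v n * channelInput s v n = ∑ n, channelInput s v n ^ 2 :=
      Finset.sum_congr rfl fun n _ => (sq _).symm
    rw [hq]
    refine Real.exp_le_exp.2 ?_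
    calc _ = -l * g + (l + l ^ 2) * ((∑ n, channelInput s v n ^ 2) / (2 * σ ^ 2)) := by
          field_simp; ring
      _ ≤ _ := by gcongr; exact hE v
  have hsum : ∑ v : Fin A, μ₀.real {y | vhat y = v} ≤ 1 := by
    rw [← measureReal_biUnion_finset (f := fun v => {y | vhat y = v})]
    · exact measureReal_le_one
    · intro a _ b _ hab
      exact Set.disjoint_left.2 fun y h1 h2 => hab (h1.symm.trans h2)
    · exact fun v _ => hv v
  have h := Finset.sum_le_sum fun (v : Fin A) (_ : v ∈ Finset.univ) => hcorrect v
  rw [Finset.sum_sub_distrib, Finset.sum_add_distrib, ← Finset.mul_sum, Finset.sum_const,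
    Finset.sum_const, nsmul_eq_mul, nsmul_eq_mul, Finset.card_univ, Fintype.card_fin, mul_one] at h
  have hg : Real.exp g * ∑ v : Fin A, μ₀.real {y | vhat y = v} ≤ Real.exp g :=
    mul_le_of_le_one_right (Real.exp_pos g).le hsum
  have e : 1 - syncErrorProb σ s vhat =
      (A - ∑ v : Fin A, (awgnOutput σ (channelInput s v)).real {y | vhat y ≠ v}) / A := by
    rw [syncErrorProb]; field_simp
  rw [e, div_le_iff₀ hA', add_mul, div_mul_cancel₀ _ hA'.ne']
  linarith

theorem tendsto_exp_neg_mul_log_natCast {A : ℕ → ℕ} (hA : Tendsto A atTop atTop) {c : ℝ}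
    (hc : 0 < c) : Tendsto (fun k => Real.exp (-(c * Real.log (A k)))) atTop (𝓝 0) :=
  Real.tendsto_exp_neg_atTop_nhds_zero.comp
    ((Real.tendsto_log_atTop.comp (tendsto_natCast_atTop_atTop.comp hA)).const_mul_atTop hc)

/-- Converse part of the synchronisation threshold. -/
theorem not_errorFreeSync {σ : ℝ} (hσ : 0 < σ) {X : ℝ → Set ℝ}
    (hXP : ∀ P : ℝ, 0 < P → ∀ x ∈ X P, x ^ 2 ≤ P) {A N : ℕ → ℕ} {P : ℕ → ℝ}
    (hA : ∀ k, 1 ≤ A k) (hP : ∀ k, 0 < P k) (hAt : Tendsto A atTop atTop) {ε : ℝ} (hε : 0 < ε)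
    (h : ∃ᶠ k in atTop, Real.exp ((N k * P k) / (2 * σ ^ 2)) ≤ (A k : ℝ) ^ (1 - ε)) :
    ¬ ErrorFreeSync σ X A N P := by
  rintro ⟨s, vhat, hs, hv, ht⟩
  have h1 := ht.eventually (gt_mem_nhds (by norm_num : (0 : ℝ) < 1 / 2))
  have h2 := (tendsto_exp_neg_mul_log_natCast hAt (c := ε / 2) (by positivity)).eventually
    (gt_mem_nhds (by norm_num : (0 : ℝ) < 1 / 4))
  have h3 := (tendsto_exp_neg_mul_log_natCast hAt (c := ε ^ 2 / 16) (by positivity)).eventually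
    (gt_mem_nhds (by norm_num : (0 : ℝ) < 1 / 4))
  obtain ⟨k, hk, h1, h2, h3⟩ := (h.and_eventually (h1.and (h2.and h3))).exists
  have hAk : (1 : ℝ) ≤ A k := by exact_mod_cast hA k
  have hlog : 0 ≤ Real.log (A k) := Real.log_nonneg hAk
  rw [Real.rpow_def_of_pos (by linarith), Real.exp_le_exp] at hk
  -- Here `g` lies halfway between `(1 - ε) log A`, which bounds `E / (2σ²)`, and `log A`. With `l =
  -- ε / 4` the tail exponent is at most `-(ε² + ε³) / 16 * log A`.
  have hb := one_sub_syncErrorProb_le hσ (hA k)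
    (fun v => sum_channelInput_sq_le (fun i => hXP _ (hP k) _ (hs k i)) (hP k).le v)
    (fun t => (hv k t).1) ((1 - ε / 2) * Real.log (A k)) (l := ε / 4) (by positivity)
  have e1 : Real.exp ((1 - ε / 2) * Real.log (A k)) / A k =
      Real.exp (-(ε / 2 * Real.log (A k))) := by
    nth_rewrite 2 [← Real.exp_log (by linarith : (0 : ℝ) < A k)]
    rw [← Real.exp_sub]; congr 1; ring
  have e2 : Real.exp (-(ε / 4) * ((1 - ε / 2) * Real.log (A k)) +
      (ε / 4 + (ε / 4) ^ 2) * (N k * P k / (2 * σ ^ 2))) ≤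
      Real.exp (-(ε ^ 2 / 16 * Real.log (A k))) := by
    refine Real.exp_le_exp.2 ?_
    have : (ε / 4 + (ε / 4) ^ 2) * (N k * P k / (2 * σ ^ 2)) ≤
      (ε / 4 + (ε / 4) ^ 2) * (Real.log (A k) * (1 - ε)) := by gcongr
    have h4 : 0 ≤ ε ^ 3 * Real.log (A k) := by positivity
    nlinarith
  linarith

/-! ### Direct part -/

/-- Direct part of the synchronisation threshold. -/
theorem errorFreeSync {σ : ℝ} (hσ : 0 < σ) {X : ℝ → Set ℝ}
    (hX : ∀ P : ℝ, 0 < P → {0, Real.sqrt P} ⊆ X P) {A N : ℕ → ℕ} {P : ℕ → ℝ}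
    (hA : ∀ k, 1 ≤ A k) (hN : ∀ k, 1 ≤ N k) (hAt : Tendsto A atTop atTop)
    {p : ℝ} (hp : 0 < p) (hpP : ∀ k, p ≤ P k) {ε : ℝ} (hε : 0 < ε)
    (h : ∀ᶠ k in atTop, (A k : ℝ) ^ (1 + ε) ≤ Real.exp ((N k * P k) / (2 * σ ^ 2))) :
    ErrorFreeSync σ X A N P := by
  have hP : ∀ k, 0 < P k := fun k => hp.trans_le (hpP k)
  -- One `η` pays for the zeros in the word and one for `d ≤ η N`; what is left of the exponent
  -- still exceeds `log A` by `ε / 2 * log A`.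
  set η := ε / (4 * (1 + ε))
  have hη : 0 < η := by positivity
  have hηε : (1 - 2 * η) * (1 + ε) = 1 + ε / 2 := by simp only [η]; field_simp; ring
  obtain ⟨c, hc, hcη, hS⟩ := exists_finset_autocorrelation_le hη
  choose S hSN hScard hSac using fun k => hS (N k) (hN k)
  set d : ℕ → ℝ := fun k => c * (N k : ℝ) ^ (2 / 3 : ℝ)
  have hd : ∀ k, 0 ≤ d k := fun k => by positivity
  refine ⟨fun k => onOffWord (N k) (S k) (P k), fun k => thresholdDecoder (hA k)
    (onOffWord (N k) (S k) (P k)) (((S k).card - d k / 2) * P k), ?_,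
    fun k => isSequentialDecoder_thresholdDecoder _ _ _, ?_⟩
  · intro k i
    apply hX _ (hP k)
    simp only [onOffWord]
    split_ifs <;> simp
  have hAr : ∀ k, (1 : ℝ) ≤ A k := fun k => by exact_mod_cast hA k
  have hNr : ∀ k, (1 : ℝ) ≤ N k := fun k => by exact_mod_cast hN k
  have hE : Tendsto (fun k => (N k : ℝ) * P k) atTop atTop := by
    have h1 : Tendsto (fun k => 2 * σ ^ 2 * Real.log (A k)) atTop atTop :=
      (Real.tendsto_log_atTop.comp (tendsto_natCast_atTop_atTop.comp hAt)).const_mul_atTop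
        (by positivity)
    refine tendsto_atTop_mono' _ ?_ h1
    filter_upwards [h] with k hk
    rw [Real.rpow_def_of_pos (by linarith [hAr k]), Real.exp_le_exp,
      le_div_iff₀ (by positivity)] at hk
    have : 0 ≤ Real.log (A k) * ε * (2 * σ ^ 2) := by
      have := Real.log_nonneg (hAr k)
      positivity
    linarith
  set u : ℕ → ℝ := fun k => ((N k : ℝ) * P k) ^ (1 / 3 : ℝ)
  have hu : Tendsto u atTop atTop := (tendsto_rpow_atTop (by norm_num)).comp hE
  -- `d² P / (8σ² N) = c² N^(1/3) P / (8σ²)` is at least `K u`, because `P^(2/3) ≥ p^(2/3)`. Since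
  -- also `N ≤ u³ / p`, the overlap term is a polynomial in `u` times `exp (-K u)`.
  set K := c ^ 2 * (p ^ (1 / 3 : ℝ)) ^ 2 / (8 * σ ^ 2)
  have hK : 0 < K := by positivity
  have hlim : Tendsto (fun k => ((p * K ^ 3)⁻¹ * ((K * u k) ^ 3 * Real.exp (-(K * u k)))
      + Real.exp (-(K * u k))) + Real.exp (-(ε / 2 * Real.log (A k)))) atTop (𝓝 0) := by
    have hKu := hu.const_mul_atTop hK
    have l1 := ((Real.tendsto_pow_mul_exp_neg_atTop_nhds_zero 3).comp hKu).const_mul (p * K ^ 3)⁻¹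
    have l2 := Real.tendsto_exp_neg_atTop_nhds_zero.comp hKu
    have l3 := tendsto_exp_neg_mul_log_natCast hAt (c := ε / 2) (by positivity)
    simpa using (l1.add l2).add l3
  refine squeeze_zero' (Eventually.of_forall fun k => ?_) ?_ hlim
  · unfold syncErrorProb; positivity
  filter_upwards [h] with k hk
  refine (syncErrorProb_onOffWord_le hσ (hA k) (hSN k) (hP k) (hd k) (hSac k)).trans ?_
  have hN0 : (0 : ℝ) ≤ N k := by positivity
  have hP0 := (hP k).le
  obtain ⟨a, ha⟩ : ∃ a, a = (N k : ℝ) ^ (1 / 3 : ℝ) := ⟨_, rfl⟩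
  obtain ⟨b, hb⟩ : ∃ b, b = P k ^ (1 / 3 : ℝ) := ⟨_, rfl⟩
  have ha0 : 0 < a := by have := hNr k; rw [ha]; positivity
  have hb0 : 0 < b := by have := hP k; rw [hb]; positivity
  have cube : ∀ x : ℝ, 0 ≤ x → (x ^ (1 / 3 : ℝ)) ^ 3 = x := fun x hx => by
    rw [← Real.rpow_natCast, ← Real.rpow_mul hx]; norm_num
  have ha3 : a ^ 3 = N k := by rw [ha, cube _ hN0]
  have hb3 : b ^ 3 = P k := by rw [hb, cube _ hP0]
  have huab : u k = a * b := by simp only [u]; rw [Real.mul_rpow hN0 hP0, ha, hb]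
  have hda : d k = c * a ^ 2 := by
    simp only [d]
    rw [ha, ← Real.rpow_natCast, ← Real.rpow_mul hN0]; norm_num
  have hpb : p ^ (1 / 3 : ℝ) ≤ b := by rw [hb]; gcongr; exact hpP k
  have hnear : Real.exp (-(d k ^ 2 * P k / (8 * σ ^ 2 * N k))) ≤ Real.exp (-(K * u k)) := by
    refine Real.exp_le_exp.2 (neg_le_neg ?_)
    have e : d k ^ 2 * P k / (8 * σ ^ 2 * N k) = c ^ 2 * b ^ 2 / (8 * σ ^ 2) * (a * b) := by
      rw [hda, ← ha3, ← hb3]; field_simp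
    rw [e, huab]
    simp only [K]
    gcongr
  have hNu : (N k : ℝ) ≤ u k ^ 3 / p := by
    rw [le_div_iff₀ hp, huab, mul_pow, ha3, hb3]
    exact mul_le_mul_of_nonneg_left (hpP k) hN0
  have hfar : A k * Real.exp (-(((S k).card - d k) * P k / (2 * σ ^ 2))) ≤
      Real.exp (-(ε / 2 * Real.log (A k))) := by
    have hdN : d k ≤ η * N k := by
      have : (N k : ℝ) ^ (2 / 3 : ℝ) ≤ (N k : ℝ) ^ (1 : ℝ) :=
        Real.rpow_le_rpow_of_exponent_le (hNr k) (by norm_num)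
      rw [Real.rpow_one] at this
      simp only [d]
      gcongr
    rw [Real.rpow_def_of_pos (by linarith [hAr k]), Real.exp_le_exp] at hk
    have hη2 : 0 ≤ 1 - 2 * η := by
      have : 0 < (1 - 2 * η) * (1 + ε) := by rw [hηε]; positivity
      exact (pos_of_mul_pos_left this (by positivity)).le
    have h1 : (1 - 2 * η) * (N k * P k / (2 * σ ^ 2)) ≤
        ((S k).card - d k) * P k / (2 * σ ^ 2) := by
      rw [← mul_div_assoc, ← mul_assoc]
      gcongr
      linarith [hScard k]
    have h2 := mul_le_mul_of_nonneg_left hk hη2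
    have h3 : (1 - 2 * η) * (Real.log (A k) * (1 + ε)) = Real.log (A k) * (1 + ε / 2) := by
      rw [← hηε]; ring
    nth_rewrite 1 [← Real.exp_log (by linarith [hAr k] : (0 : ℝ) < A k)]
    rw [← Real.exp_add]
    refine Real.exp_le_exp.2 ?_
    linarith
  refine add_le_add ?_ hfar
  calc (N k + 1) * Real.exp (-(d k ^ 2 * P k / (8 * σ ^ 2 * N k)))
      ≤ (u k ^ 3 / p + 1) * Real.exp (-(K * u k)) := by gcongr
    _ = _ := by field_simp

/-! ### From interval lengths to exponents -/

theorem one_le_intervalLength {α E : ℝ} (h : 0 ≤ α * E) : 1 ≤ intervalLength α E :=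
  Nat.le_floor (by simpa using h)

theorem tendsto_intervalLength {α : ℝ} (hα : 0 < α) {E : ℕ → ℝ} (hE : Tendsto E atTop atTop) :
    Tendsto (fun k => intervalLength α (E k)) atTop atTop :=
  tendsto_nat_floor_atTop.comp (Real.tendsto_exp_atTop.comp (hE.const_mul_atTop hα))

theorem intervalLength_rpow_le {α β E : ℝ} (hβ : 0 ≤ β) :
    (intervalLength α E : ℝ) ^ β ≤ Real.exp (α * E * β) := by
  rw [Real.exp_mul]
  gcongr
  exact Nat.floor_le (Real.exp_pos _).le

/-- Rounding down a number that is at least 1 loses at most a factor 2, a constant in the exponent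
that a growing energy absorbs. -/
theorem exp_half_le_intervalLength {α E : ℝ} (h : 0 ≤ α * E) :
    Real.exp (α * E - Real.log 2) ≤ intervalLength α E := by
  rw [Real.exp_sub, Real.exp_log two_pos, div_le_iff₀ two_pos]
  have h1 := Nat.lt_floor_add_one (Real.exp (α * E))
  have h2 : (1 : ℝ) ≤ intervalLength α E := by exact_mod_cast one_le_intervalLength h
  unfold intervalLength at *
  linarith

theorem mem_achievableExponentsAlong {σ : ℝ} (hσ : 0 < σ) {X : ℝ → Set ℝ}
    (hX : ∀ P : ℝ, 0 < P → {0, Real.sqrt P} ⊆ X P) {N : ℕ → ℕ} {P : ℕ → ℝ}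
    (hN : ∀ k, 1 ≤ N k) {p : ℝ} (hp : 0 < p) (hpP : ∀ k, p ≤ P k)
    (hE : Tendsto (fun k => (N k : ℝ) * P k) atTop atTop) {α : ℝ} (hα : 0 < α)
    (hασ : α < 1 / (2 * σ ^ 2)) : α ∈ achievableExponentsAlong σ X N P := by
  have hE0 : ∀ k, 0 ≤ (N k : ℝ) * P k := fun k =>
    mul_nonneg (Nat.cast_nonneg _) (hp.le.trans (hpP k))
  obtain ⟨ε, hε, hle⟩ : ∃ ε : ℝ, 0 < ε ∧ α * (1 + ε) = 1 / (2 * σ ^ 2) :=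
    ⟨1 / (2 * σ ^ 2) / α - 1, by rw [sub_pos, one_lt_div hα]; exact hασ, by field_simp; ring⟩
  refine ⟨hα, errorFreeSync hσ hX (fun k => one_le_intervalLength (mul_nonneg hα.le (hE0 k))) hN
    (tendsto_intervalLength hα hE) hp hpP hε (Eventually.of_forall fun k => ?_)⟩
  refine (intervalLength_rpow_le (by positivity)).trans_eq ?_
  congr 1
  rw [mul_right_comm, hle]; ring

theorem le_of_mem_achievableExponentsAlong {σ : ℝ} (hσ : 0 < σ) {X : ℝ → Set ℝ}
    (hXP : ∀ P : ℝ, 0 < P → ∀ x ∈ X P, x ^ 2 ≤ P) {N : ℕ → ℕ} {P : ℕ → ℝ}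
    (hP : ∀ k, 0 < P k) (hE : Tendsto (fun k => (N k : ℝ) * P k) atTop atTop) {α : ℝ}
    (h : α ∈ achievableExponentsAlong σ X N P) : α ≤ 1 / (2 * σ ^ 2) := by
  obtain ⟨hα, h⟩ := h
  by_contra! hlt
  have hE0 : ∀ k, 0 ≤ (N k : ℝ) * P k := fun k => mul_nonneg (Nat.cast_nonneg _) (hP k).le
  set θ := 1 / (2 * σ ^ 2)
  have hθ : 0 < θ := by positivity
  -- Chosen so that `α (1 - ε)` is the midpoint of `θ` and `α`; the excess `(α - θ) / 2 * E`
  -- eventually covers the rounding loss.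
  set ε := (α - θ) / (2 * α)
  have hε : 0 < ε := div_pos (by linarith) (by linarith)
  have hαε : α * (1 - ε) = θ + (α - θ) / 2 := by simp only [ε]; field_simp; ring
  have hε1 : 0 ≤ 1 - ε := by
    have : 0 < α * (1 - ε) := by rw [hαε]; linarith
    exact (pos_of_mul_pos_right this hα.le).le
  refine not_errorFreeSync hσ hXP
    (fun k => one_le_intervalLength (mul_nonneg hα.le (hE0 k))) hP
    (tendsto_intervalLength hα hE) hε (Eventually.frequently ?_) h
  filter_upwards [(hE.const_mul_atTop (by linarith : 0 < (α - θ) / 2)).eventually_ge_atTop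
    (Real.log 2 * (1 - ε))] with k hk
  calc Real.exp (N k * P k / (2 * σ ^ 2))
      ≤ Real.exp ((α * (N k * P k) - Real.log 2) * (1 - ε)) := by
        refine Real.exp_le_exp.2 ?_
        have e1 : (N k : ℝ) * P k / (2 * σ ^ 2) = θ * (N k * P k) := by simp only [θ]; ring
        have e2 : (α * (N k * P k) - Real.log 2) * (1 - ε) =
          (α * (1 - ε)) * (N k * P k) - Real.log 2 * (1 - ε) := by ring
        rw [e1, e2, hαε]
        linarith
    _ ≤ _ := by
        rw [Real.exp_mul]
        gcongr
        exact exp_half_le_intervalLength (mul_nonneg hα.le (hE0 k))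

theorem isEnergySyncThresholdAlong {σ : ℝ} (hσ : 0 < σ) {X : ℝ → Set ℝ}
    (hX : ∀ P : ℝ, 0 < P → {0, Real.sqrt P} ⊆ X P)
    (hXP : ∀ P : ℝ, 0 < P → ∀ x ∈ X P, x ^ 2 ≤ P) {N : ℕ → ℕ} {P : ℕ → ℝ}
    (hN : ∀ k, 1 ≤ N k) {p : ℝ} (hp : 0 < p) (hpP : ∀ k, p ≤ P k)
    (hE : Tendsto (fun k => (N k : ℝ) * P k) atTop atTop) :
    IsEnergySyncThresholdAlong σ X N P (1 / (2 * σ ^ 2)) := by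
  refine ⟨fun α hα => le_of_mem_achievableExponentsAlong hσ hXP (fun k => hp.trans_le (hpP k)) hE hα,
    fun b hb => ?_⟩
  have hθ : 0 < 1 / (2 * σ ^ 2) := by positivity
  refine le_of_forall_lt_imp_le_of_dense fun c hc => ?_
  -- The maximum with 0 is needed because exponents are positive.
  obtain ⟨α, h1, h2⟩ := exists_between (max_lt hc hθ)
  exact (max_lt_iff.1 h1).1.le.trans
    (hb (mem_achievableExponentsAlong hσ hX hN hp hpP hE (max_lt_iff.1 h1).2 h2))

theorem mainTheorem5 (σ : ℝ) (hσ : 0 < σ)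
    (X : ℝ → Set ℝ)
    (hX : ∀ P : ℝ, 0 < P → {0, Real.sqrt P} ⊆ X P)
    (hXP : ∀ P : ℝ, 0 < P → ∀ x ∈ X P, x ^ 2 ≤ P) :
    IsEnergySyncThreshold σ X (1 / (2 * σ ^ 2)) ∧
    (∀ (N : ℕ → ℕ) (P : ℕ → ℝ), (∀ k, 1 ≤ N k) → (∀ k, 0 < P k) →
      (∃ p : ℝ, 0 < p ∧ ∀ k, p ≤ P k) →
      Tendsto (fun k => (N k : ℝ) * P k) atTop atTop →
      IsEnergySyncThresholdAlong σ X N P (1 / (2 * σ ^ 2))) ∧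
    (∀ (A N : ℕ → ℕ) (P : ℕ → ℝ), (∀ k, 1 ≤ A k) → (∀ k, 1 ≤ N k) → (∀ k, 0 < P k) →
      Tendsto A atTop atTop →
      ((∃ p : ℝ, 0 < p ∧ ∀ k, p ≤ P k) →
        (∃ ε : ℝ, 0 < ε ∧
          ∀ᶠ k in atTop, (A k : ℝ) ^ (1 + ε) ≤ Real.exp ((N k * P k) / (2 * σ ^ 2))) →
        ErrorFreeSync σ X A N P) ∧
      ((∃ ε : ℝ, 0 < ε ∧
          ∃ᶠ k in atTop, Real.exp ((N k * P k) / (2 * σ ^ 2)) ≤ (A k : ℝ) ^ (1 - ε)) →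
        ¬ ErrorFreeSync σ X A N P)) := by

  refine ⟨⟨?_, fun b hb => ?_⟩, ?_, ?_⟩
  · rintro α ⟨N, P, -, hP, hE, hα⟩
    exact le_of_mem_achievableExponentsAlong hσ hXP hP hE hα
  -- One admissible scaling already attains the supremum: unit power and growing length.
  · have hE : Tendsto (fun k : ℕ => ((k + 1 : ℕ) : ℝ) * (1 : ℝ)) atTop atTop := by
      simp_rw [mul_one]
      exact tendsto_natCast_atTop_atTop.comp (tendsto_add_atTop_nat 1)
    exact (isEnergySyncThresholdAlong hσ hX hXP (N := fun k => k + 1) (P := fun _ => 1)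
      (fun k => by omega) one_pos (fun _ => le_rfl) hE).2 fun α hα =>
        hb ⟨_, _, fun k => by omega, fun _ => one_pos, hE, hα⟩
  · rintro N P hN hP ⟨p, hp, hpP⟩ hE
    exact isEnergySyncThresholdAlong hσ hX hXP hN hp hpP hE
  · intro A N P hA hN hP hAt
    exact ⟨fun ⟨p, hp, hpP⟩ ⟨ε, hε, h⟩ => errorFreeSync hσ hX hA hN hAt hp hpP hε h,
      fun ⟨ε, hε, h⟩ => not_errorFreeSync hσ hXP hA hP hAt hε h⟩
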